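/- Conventions. Let $S$ be a commutative monoid with a partial order that is compatible with addition and satisfies $0\le a$ for all $a\in S$. For $a,b\in S$ write $a\ll b$ if for every increasing sequence $(b_n)_n$ in $S$ that has a supremum with $b\le\sup_n b_n$, there is $n$ with $a\le b_n$. Then $S$ is a *Cu-semigroup* if (O1) every increasing sequence has a supremum; (O2) every element is the supremum of a $\ll$-increasing sequence; (O3) $a'\ll a$ and $b'\ll b$ imply $a'+b'\ll a+b$; (O4) $\sup_n(a_n+b_n)=\sup_n a_n+\sup_n b_n$ for all increasing sequences $(a_n)_n,(b_n)_n$. It satisfies - (O5) if whenever $a+b\le c$, $a'\ll a$ and $b'\ll b$, there is $x\in S$ with $a'+x\le c\le a+x$ and $b'\ll x$; - (O6) if whenever $a'\ll a\le b+c$, there are $e,f\in S$ with $a'\le e+f$, $e\le a,b$ and $f\le a,c$. $S$ is *countably based* if there is a countable $B\subseteq S$ such that every element of $S$ is the supremum of an increasing sequence in $B$. An *ideal* is a downward hereditary submonoid closed under suprema of increasing sequences; $S$ is *simple* if its only ideals are $\{0\}$ and $S$; a simple $S$ is *elementary* if it has a minimal nonzero element. An element $u$ is *compact* if $u\ll u$,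 and *full* if $S$ is the only ideal containing $u$. A *functional* on $S$ is a map $\lambda\colon S\to[0,\infty]$ that preserves zero, addition, order and suprema of increasing sequences. Let $F_{u\mapsto 1}(S)$ be the convex set of functionals $\lambda$ with $\lambda(u)=1$. For $K=F_{u\mapsto1}(S)$ let $\partial_eK$ be its set of extreme points. $S$ satisfies *Edwards' condition for $\partial_eK$* if $$\min\{\lambda(a),\lambda(b)\}=\sup\{\lambda(c): c\in S,\ c\le a,\ c\le b\}\qquad\text{for all }\lambda\in\partial_eK\text{ and all }a,b\in S.$$ For $a\in S$ let $\widehat a(\lambda)=\lambda(a)$. For $\lambda\in\partial_eK$ let $\sigma_\lambda\colon K\to(-\infty,\infty]$ be given by $\sigma_\lambda(\lambda)=0$ and $\sigma_\lambda(\mu)=\infty$ for $\mu\ne\lambda$; the function $t+\sigma_\lambda$ is the *chisel* at $\lambda$ with value $t\in\mathbb R$. **Proposition.** Let $S$ be a countably based, simple, non-elementary Cu-semigroup satisfying (O5) and (O6), let $u\in S$ be a compact, full element, and set $K:=F_{u\mapsto1}(S)$. Assume that $S$ satisfies Edwards' condition for $\partial_eK$. Then for every $\lambda\in\partial_eK$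 and every real $t>0$ there exists $a\in S$ with $\widehat a|_K=t+\sigma_\lambda$. -/

import Mathlib

open scoped NNReal ENNReal

/-- The sequential way-below relation (compact containment) `a ≪ b` in a partially ordered set. -/
def CuBelow {S : Type*} [PartialOrder S] (a b : S) : Prop :=
  ∀ f : ℕ → S, Monotone f → ∀ s : S, IsLUB (Set.range f) s → b ≤ s → ∃ n, a ≤ f n

/-- Abstract Cuntz semigroups: positively ordered monoids satisfying (O1)-(O4). Compatibility of
addition and order is the Mathlib class `IsOrderedAddMonoid`. -/
class CuSemigroup (S : Type*) [AddCommMonoid S] [PartialOrder S] [IsOrderedAddMonoid S] :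
    Prop where
  /-- The order is positive. -/
  zero_le' : ∀ a : S, 0 ≤ a
  /-- (O1): increasing sequences have suprema. -/
  exists_sup : ∀ f : ℕ → S, Monotone f → ∃ s, IsLUB (Set.range f) s
  /-- (O2): every element is the supremum of a `≪`-increasing sequence. -/
  exists_seq : ∀ a : S, ∃ f : ℕ → S,
    (∀ n, CuBelow (f n) (f (n + 1))) ∧ IsLUB (Set.range f) a
  /-- (O3): addition is compatible with `≪`. -/
  add_below : ∀ a' a b' b : S, CuBelow a' a → CuBelow b' b → CuBelow (a' + b') (a + b)
  /-- (O4): addition is compatible with suprema of increasing sequences. -/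
  sup_add : ∀ (f g : ℕ → S) (a b : S), Monotone f → Monotone g →
    IsLUB (Set.range f) a → IsLUB (Set.range g) b → IsLUB (Set.range fun n => f n + g n) (a + b)

section

variable (S : Type*) [AddCommMonoid S] [PartialOrder S]

/-- Axiom (O5): almost algebraic order. -/
def AxiomO5 : Prop :=
  ∀ a' a b' b c : S, a + b ≤ c → CuBelow a' a → CuBelow b' b →
    ∃ x : S, a' + x ≤ c ∧ c ≤ a + x ∧ CuBelow b' x

/-- Axiom (O6): almost Riesz decomposition. -/
def AxiomO6 : Prop :=
  ∀ a' a b c : S, CuBelow a' a → a ≤ b + c →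
    ∃ e f : S, a' ≤ e + f ∧ e ≤ a ∧ e ≤ b ∧ f ≤ a ∧ f ≤ c

/-- `S` is countably based. -/
def IsCountablyBased : Prop :=
  ∃ B : Set S, B.Countable ∧
    ∀ a : S, ∃ f : ℕ → S, Monotone f ∧ (∀ n, f n ∈ B) ∧ IsLUB (Set.range f) a

variable {S}

/-- Ideals: downward hereditary submonoids closed under suprema of increasing sequences. -/
structure IsCuIdeal (J : AddSubmonoid S) : Prop where
  mem_of_le : ∀ a b : S, a ≤ b → b ∈ J → a ∈ J
  sup_mem : ∀ (f : ℕ → S) (s : S), Monotone f → (∀ n, f n ∈ J) → IsLUB (Set.range f) s → s ∈ J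

variable (S) in
/-- `S` is simple: its only ideals are `{0}` and `S`. -/
def IsSimpleCu : Prop :=
  ∀ J : AddSubmonoid S, IsCuIdeal J → J = ⊥ ∨ J = ⊤

variable (S) in
/-- `S` is elementary (a notion used for simple `S`): it has a minimal nonzero element. -/
def IsElementaryCu : Prop :=
  ∃ a : S, Minimal (fun x : S => x ≠ 0) a

/-- `u` is full: the only ideal containing it is `S`. -/
def IsFullElement (u : S) : Prop :=
  ∀ J : AddSubmonoid S, IsCuIdeal J → u ∈ J → J = ⊤

/-- `u` is compact: `u ≪ u`. -/
def IsCompactElt (u : S) : Prop := CuBelow u u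

/-- Functionals on `S`: maps `S → [0, ∞]` preserving zero, addition, order and suprema of
increasing sequences. -/
structure IsCuFunctional (φ : S → ℝ≥0∞) : Prop where
  map_zero : φ 0 = 0
  map_add : ∀ a b : S, φ (a + b) = φ a + φ b
  mono : Monotone φ
  map_sup : ∀ (f : ℕ → S) (s : S), Monotone f → IsLUB (Set.range f) s →
    IsLUB (Set.range fun n => φ (f n)) (φ s)

/-- The convex set `F_{u ↦ 1}(S)` of functionals normalized at `u`, inside the cone of all functions
`S → [0, ∞]` with pointwise addition and scalar multiplication. -/
def normalizedFunctionals (u : S) : Set (S → ℝ≥0∞) :=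
  {φ | IsCuFunctional φ ∧ φ u = 1}

/-- The extreme boundary of `F_{u ↦ 1}(S)`. -/
def extremeFunctionals (u : S) : Set (S → ℝ≥0∞) :=
  (normalizedFunctionals u).extremePoints ℝ≥0

/-- Edwards' condition for a functional `φ`. -/
def EdwardsConditionFor (φ : S → ℝ≥0∞) : Prop :=
  ∀ a b : S, min (φ a) (φ b) = sSup {r | ∃ c : S, c ≤ a ∧ c ≤ b ∧ φ c = r}

/-- The rank function of `a`, restricted to `F_{u ↦ 1}(S)`, as an extended-real-valued function. -/
noncomputable def rankOn (u a : S) : normalizedFunctionals u → EReal :=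
  fun φ => ((φ : S → ℝ≥0∞) a : EReal)

end

open Classical in
/-- The function `σ_x` on `K`, with value `0` at `x` and `∞` elsewhere. -/
noncomputable def chiselBase {E : Type*} (K : Set E) (x : E) : K → EReal :=
  fun y => if (y : E) = x then 0 else ⊤

/-- The chisel `t + σ_x` at `x` with value `t`. -/
noncomputable def chisel {E : Type*} (K : Set E) (x : E) (t : ℝ) : K → EReal :=
  fun y => (t : EReal) + chiselBase K x y

/-! Fix an extreme `φ`. The required element is a supremum of elements of `φ`-rank below `t`, built
so that its rank dominates, at every point of `K`, that of each `b` with `φ b < t`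
(`exists_dominating`). Such a supremum exists because these elements are directed
(`exists_upper_bound`): Edwards' condition supplies lower bounds, and taking complements in a
multiple of the compact `u` by (O5) turns them into upper bounds. At `φ` the value is exactly `t`,
since multiples of elements of tiny rank come arbitrarily close to `t` (`le_of_forall_rank_lt`). At
`μ ≠ φ` it is infinite (`exists_lt_rank`): if `μ` were bounded on `{φ < t}`, it would be dominated
by a multiple of `φ`, and extremality would force `μ = φ` (`eq_of_le_mul`). -/

namespace CuBelow

variable {S : Type*} [PartialOrder S] {a b c : S}

theorem le (h : CuBelow a b) : a ≤ b := by
  obtain ⟨n, hn⟩ := h (fun _ => b) monotone_const b (by simp) le_rfl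
  exact hn

theorem trans_le (h : CuBelow a b) (hbc : b ≤ c) : CuBelow a c :=
  fun f hf s hs hc => h f hf s hs (hbc.trans hc)

theorem of_le (hab : a ≤ b) (h : CuBelow b c) : CuBelow a c := fun f hf s hs hc =>
  (h f hf s hs hc).imp fun _ hn => hab.trans hn

end CuBelow

theorem EdwardsConditionFor.exists_lt {S : Type*} [PartialOrder S] {φ : S → ℝ≥0∞} (h : EdwardsConditionFor φ) {a b : S}
    {r : ℝ≥0∞} (ha : r < φ a) (hb : r < φ b) : ∃ c, c ≤ a ∧ c ≤ b ∧ r < φ c := by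
  have := lt_min ha hb
  rw [h a b, lt_sSup_iff] at this
  obtain ⟨_, ⟨c, hca, hcb, rfl⟩, hc⟩ := this
  exact ⟨c, hca, hcb, hc⟩

/-! ### Functionals: kernels and scaling estimates. -/

section Functionals

variable {S : Type*} [AddCommMonoid S] [PartialOrder S] {φ : S → ℝ≥0∞}

namespace IsCuFunctional

theorem eq_iSup (hφ : IsCuFunctional φ) {f : ℕ → S} {s : S} (hf : Monotone f)
    (hs : IsLUB (Set.range f) s) : φ s = ⨆ n, φ (f n) :=
  (hφ.map_sup f s hf hs).iSup_eq.symm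

theorem map_nsmul (hφ : IsCuFunctional φ) (n : ℕ) (a : S) : φ (n • a) = n * φ a := by
  induction n with
  | zero => simp [hφ.map_zero]
  | succ n ih => rw [succ_nsmul, hφ.map_add, ih]; push_cast; ring

theorem const_mul (hφ : IsCuFunctional φ) (r : ℝ≥0∞) : IsCuFunctional fun a => r * φ a where
  map_zero := by simp [hφ.map_zero]
  map_add a b := by rw [hφ.map_add, mul_add]
  mono a b h := mul_le_mul_right (hφ.mono h) r
  map_sup f s hf hs := by
    rw [hφ.eq_iSup hf hs, ENNReal.mul_iSup]
    exact isLUB_iSup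

/-- The kernel of `φ` is an ideal missing `u`, hence trivial by simplicity. -/
theorem ne_zero (hsimple : IsSimpleCu S) (hφ : IsCuFunctional φ) {u a : S} (hu : φ u ≠ 0)
    (ha : a ≠ 0) : φ a ≠ 0 := by
  let J : AddSubmonoid S :=
    { carrier := {x | φ x = 0}
      zero_mem' := hφ.map_zero
      add_mem' := fun {x y} hx hy => by
        change φ (x + y) = 0
        rw [hφ.map_add, show φ x = 0 from hx, show φ y = 0 from hy, add_zero] }
  have hJ : IsCuIdeal J := by
    refine ⟨fun x y hxy hy => ?_, fun f s hm hf hs => ?_⟩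
    · exact le_antisymm ((hφ.mono hxy).trans (le_of_eq hy)) zero_le
    · change φ s = 0
      rw [hφ.eq_iSup hm hs]
      exact ENNReal.iSup_eq_zero.2 hf
  intro h
  rcases hsimple J hJ with h0 | h1
  · have : a ∈ J := h
    rw [h0] at this
    exact ha (AddSubmonoid.mem_bot.1 this)
  · exact hu (show u ∈ J from h1 ▸ AddSubmonoid.mem_top u)

end IsCuFunctional

/-- If `μ` is bounded on the elements of small `φ`-rank, it is dominated there by a multiple
of `φ`. -/
theorem mul_le_of_bounded {μ : S → ℝ≥0∞} (hφ : IsCuFunctional φ) (hμ : IsCuFunctional μ)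
    {t N : ℝ≥0∞} (ht : t ≠ ⊤) (hN : ∀ b, φ b < t → μ b ≤ N) {b : S} (hb0 : φ b ≠ 0)
    (hb : φ b < t) : μ b * t ≤ 2 * N * φ b := by
  have hex : ∃ k : ℕ, t ≤ ((k + 1 : ℕ) : ℝ≥0∞) * φ b := by
    obtain ⟨k, hk⟩ := ENNReal.exists_nat_mul_gt hb0 ht
    refine ⟨k, hk.le.trans ?_⟩
    gcongr
    exact Nat.le_succ k
  -- `k + 1` is the largest number of copies of `b` with total `φ`-rank below `t`; the factor `2`
  -- comes from `k + 2 ≤ 2 * (k + 1)`.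
  obtain ⟨k, hk, hmin⟩ : ∃ k : ℕ, t ≤ ((k + 2 : ℕ) : ℝ≥0∞) * φ b ∧
      ((k + 1 : ℕ) : ℝ≥0∞) * φ b < t := by
    classical
    have h1 := Nat.find_spec hex
    have h2 := fun m => Nat.find_min hex (m := m)
    generalize Nat.find hex = j at h1 h2
    cases j with
    | zero => exact absurd h1 (by simpa using hb)
    | succ j => exact ⟨j, h1, not_le.1 (h2 j (Nat.lt_succ_self j))⟩
  rw [← hφ.map_nsmul] at hmin
  have h3 := hN _ hmin
  rw [hμ.map_nsmul] at h3
  calc μ b * t ≤ μ b * (((k + 2 : ℕ) : ℝ≥0∞) * φ b) := by gcongr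
    _ ≤ μ b * (((2 * (k + 1) : ℕ) : ℝ≥0∞) * φ b) := by gcongr; omega
    _ = 2 * (((k + 1 : ℕ) : ℝ≥0∞) * μ b) * φ b := by push_cast; ring
    _ ≤ 2 * N * φ b := by gcongr

end Functionals

/-! ### Compact containment, small ranks and differences of functionals. -/

section CuSemigroup

variable {S : Type*} [AddCommMonoid S] [PartialOrder S] [IsOrderedAddMonoid S] [CuSemigroup S]

theorem cuBelow_zero (a : S) : CuBelow 0 a := fun _ _ _ _ _ => ⟨0, CuSemigroup.zero_le' _⟩

/-- A `≪`-increasing sequence with supremum `a`, in the form in which it is used. -/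
theorem exists_approx (a : S) : ∃ f : ℕ → S, Monotone f ∧ (∀ n, CuBelow (f n) (f (n + 1))) ∧
    (∀ n, CuBelow (f n) a) ∧ IsLUB (Set.range f) a := by
  obtain ⟨f, hf, hs⟩ := CuSemigroup.exists_seq a
  exact ⟨f, monotone_nat_of_le_succ fun n => (hf n).le, hf,
    fun n => (hf n).trans_le (hs.1 ⟨n + 1, rfl⟩), hs⟩

theorem CuBelow.exists_between {a b : S} (h : CuBelow a b) : ∃ c, CuBelow a c ∧ CuBelow c b := by
  obtain ⟨f, hm, hf, hb, hs⟩ := exists_approx b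
  obtain ⟨n, hn⟩ := h f hm b hs le_rfl
  exact ⟨f (n + 1), (hf n).of_le hn, hb _⟩

theorem exists_ne_zero_cuBelow {a : S} (ha : a ≠ 0) : ∃ b, b ≠ 0 ∧ CuBelow b a := by
  obtain ⟨f, -, -, hb, hs⟩ := exists_approx a
  by_contra! h
  refine ha (le_antisymm (hs.2 ?_) (CuSemigroup.zero_le' a))
  rintro _ ⟨n, rfl⟩
  by_contra hn
  exact h (f n) (fun h0 => hn h0.le) (hb n)

theorem IsCompactElt.nsmul {u : S} (hu : IsCompactElt u) (n : ℕ) : IsCompactElt (n • u) := by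
  induction n with
  | zero => exact (zero_nsmul u).symm ▸ cuBelow_zero (0 : S)
  | succ n ih =>
    rw [succ_nsmul]
    exact CuSemigroup.add_below _ _ _ _ ih hu

/-- Elements compactly contained in some element are dominated by a multiple of a full element. -/
theorem IsFullElement.exists_le_nsmul {u : S} (hu : IsFullElement u) {a b : S}
    (hab : CuBelow a b) : ∃ n : ℕ, a ≤ n • u := by
  have hm : Monotone fun n : ℕ => n • u :=
    fun m n h => nsmul_le_nsmul_left (CuSemigroup.zero_le' u) h
  obtain ⟨s, hs⟩ := CuSemigroup.exists_sup _ hm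
  -- This makes the elements below `s` a submonoid, and so an ideal containing `u`.
  have hss : s + s ≤ s := by
    refine (CuSemigroup.sup_add _ _ _ _ hm hm hs hs).2 ?_
    rintro _ ⟨n, rfl⟩
    exact hs.1 ⟨n + n, add_nsmul u n n⟩
  let J : AddSubmonoid S :=
    { carrier := {x | x ≤ s}
      zero_mem' := CuSemigroup.zero_le' s
      add_mem' := fun hx hy => (add_le_add hx hy).trans hss }
  have hJ : J = ⊤ := by
    refine hu J ⟨fun x y hxy hy => le_trans hxy hy, fun f x _ hf hx => hx.2 ?_⟩ ?_
    · rintro _ ⟨n, rfl⟩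
      exact hf n
    · exact hs.1 ⟨1, one_nsmul u⟩
  have hb : b ∈ J := hJ ▸ AddSubmonoid.mem_top b
  exact hab _ hm s hs hb

namespace IsCuFunctional

variable {φ μ : S → ℝ≥0∞}

theorem exists_cuBelow_lt (hφ : IsCuFunctional φ) {a : S} {r : ℝ≥0∞} (h : r < φ a) :
    ∃ b, CuBelow b a ∧ r < φ b := by
  obtain ⟨f, hm, -, hb, hs⟩ := exists_approx a
  rw [hφ.eq_iSup hm hs, lt_iSup_iff] at h
  obtain ⟨n, hn⟩ := h
  exact ⟨f n, hb n, hn⟩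

/-- Simple non-elementary Cu-semigroups have nonzero elements of arbitrarily small rank. -/
theorem exists_small (hsimple : IsSimpleCu S) (hnonelem : ¬ IsElementaryCu S) (hO5 : AxiomO5 S)
    (hφ : IsCuFunctional φ) {u : S} (hu : φ u = 1) {ε : ℝ≥0∞} (hε : ε ≠ 0) :
    ∃ d, φ d ≠ 0 ∧ φ d < ε := by
  have key : ∀ n : ℕ, ∃ d, d ≠ 0 ∧ φ d ≤ (2⁻¹ : ℝ≥0∞) ^ n := by
    intro n
    induction n with
    | zero =>
      refine ⟨u, fun h => ?_, by simp [hu]⟩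
      rw [h, hφ.map_zero] at hu
      exact zero_ne_one hu
    | succ n ih =>
      obtain ⟨a, ha, hle⟩ := ih
      obtain ⟨b, hb, hba, hab⟩ : ∃ b, b ≠ 0 ∧ b ≤ a ∧ ¬ a ≤ b := by
        by_contra! h
        exact hnonelem ⟨a, ha, fun b hb hba => h b hb hba⟩
      obtain ⟨b', hb', hbb⟩ := exists_ne_zero_cuBelow hb
      -- `b'` and the almost complement `x` are nonzero and `b' + x ≤ a`, so one of them has at most
      -- half the bound on the rank of `a`.
      obtain ⟨x, h1, h2, -⟩ := hO5 b' b 0 0 a (by simpa using hba) hbb (cuBelow_zero 0)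
      have hx : x ≠ 0 := by
        rintro rfl
        exact hab (by simpa using h2)
      have hsum : φ b' + φ x ≤ (2⁻¹ : ℝ≥0∞) ^ n :=
        (hφ.map_add b' x).symm.le.trans ((hφ.mono h1).trans hle)
      by_contra! hcon
      have h3 := ENNReal.add_lt_add (hcon b' hb') (hcon x hx)
      rw [pow_succ, ← mul_add, ENNReal.inv_two_add_inv_two, mul_one] at h3
      exact absurd hsum (not_le.2 h3)
  obtain ⟨n, hn⟩ := ENNReal.exists_inv_two_pow_lt hε
  obtain ⟨d, hd, hdn⟩ := key n
  exact ⟨d, hφ.ne_zero hsimple (hu ▸ one_ne_zero) hd, hdn.trans_lt hn⟩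

theorem ne_top_of_cuBelow (hφ : IsCuFunctional φ) {u : S} (hfull : IsFullElement u)
    (hu : φ u = 1) {a b : S} (h : CuBelow a b) : φ a ≠ ⊤ := by
  obtain ⟨n, hn⟩ := hfull.exists_le_nsmul h
  refine ne_top_of_le_ne_top (ENNReal.natCast_ne_top n) ((hφ.mono hn).trans ?_)
  rw [hφ.map_nsmul, hu, mul_one]

/-- Under (O5), a functional that is pointwise dominated is a summand. -/
theorem exists_add_eq (hO5 : AxiomO5 S) (hφ : IsCuFunctional φ) (hμ : IsCuFunctional μ)
    (hfin : ∀ a b, CuBelow a b → φ a ≠ ⊤) (hle : ∀ a, μ a ≤ φ a) :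
    ∃ ν, IsCuFunctional ν ∧ ∀ a, φ a = μ a + ν a := by
  have hfinμ : ∀ a b, CuBelow a b → μ a ≠ ⊤ := fun a b h => ne_top_of_le_ne_top (hfin a b h) (hle a)
  -- Monotonicity of `φ - μ`: an (O5) complement `x` of `a` in `b` accounts for the increments of
  -- both functionals, and `μ x ≤ φ x`.
  have hmono : ∀ a b c, a ≤ b → CuBelow b c → φ a - μ a ≤ φ b - μ b := by
    intro a b c hab hbc
    have hac := hbc.of_le hab
    have key : φ a + μ b ≤ φ b + μ a := by
      obtain ⟨f, hm, -, hf, hs⟩ := exists_approx a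
      rw [hφ.eq_iSup hm hs, ENNReal.iSup_add]
      refine iSup_le fun n => ?_
      obtain ⟨x, h1, h2, -⟩ := hO5 (f n) a 0 0 b (by simpa using hab) (hf n) (cuBelow_zero 0)
      have h3 := hφ.mono h1
      have h4 := hμ.mono h2
      rw [hφ.map_add] at h3
      rw [hμ.map_add] at h4
      calc φ (f n) + μ b ≤ φ (f n) + (μ a + φ x) := by gcongr; exact h4.trans (by gcongr; exact hle x)
        _ = (φ (f n) + φ x) + μ a := by ring
        _ ≤ φ b + μ a := by gcongr
    rw [tsub_le_iff_right, ← ENNReal.add_le_add_iff_right (hfinμ b c hbc)]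
    calc φ a + μ b ≤ φ b + μ a := key
      _ = (φ b - μ b + μ b) + μ a := by rw [tsub_add_cancel_of_le (hle b)]
      _ = φ b - μ b + μ a + μ b := by ring
  have hadd : ∀ a b c d, CuBelow a c → CuBelow b d →
      φ (a + b) - μ (a + b) = (φ a - μ a) + (φ b - μ b) := by
    intro a b c d hac hbd
    have h1 := hfinμ a c hac
    have h2 := hfinμ b d hbd
    rw [hφ.map_add, hμ.map_add]
    refine ENNReal.sub_eq_of_eq_add (ENNReal.add_ne_top.2 ⟨h1, h2⟩) ?_
    calc φ a + φ b = (φ a - μ a + μ a) + (φ b - μ b + μ b) := by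
          rw [tsub_add_cancel_of_le (hle a), tsub_add_cancel_of_le (hle b)]
      _ = _ := by ring
  -- The difference behaves well only where ranks are finite, so it is regularized from compactly
  -- contained elements.
  refine ⟨fun a => ⨆ b, ⨆ _ : CuBelow b a, (φ b - μ b), ⟨?_, ?_, ?_, ?_⟩, ?_⟩
  · refine le_antisymm (iSup₂_le fun b hb => ?_) zero_le
    rw [le_antisymm hb.le (CuSemigroup.zero_le' b), hφ.map_zero, zero_tsub]
  · intro a b
    refine le_antisymm (iSup₂_le fun c hc => ?_) ?_
    · obtain ⟨f, hfm, -, hf, hfs⟩ := exists_approx a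
      obtain ⟨g, hgm, -, hg, hgs⟩ := exists_approx b
      obtain ⟨n, hn⟩ := hc _ (hfm.add hgm) _ (CuSemigroup.sup_add f g a b hfm hgm hfs hgs) le_rfl
      refine (hmono _ _ _ hn (CuSemigroup.add_below _ _ _ _ (hf n) (hg n))).trans ?_
      rw [hadd _ _ _ _ (hf n) (hg n)]
      exact add_le_add (le_iSup₂_of_le (f n) (hf n) le_rfl) (le_iSup₂_of_le (g n) (hg n) le_rfl)
    · refine ENNReal.biSup_add_biSup_le' (p := fun x => CuBelow x a) (q := fun x => CuBelow x b)
        ⟨0, cuBelow_zero a⟩ ⟨0, cuBelow_zero b⟩ fun x hx y hy => ?_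
      rw [← hadd _ _ _ _ hx hy]
      exact le_iSup₂_of_le (x + y) (CuSemigroup.add_below _ _ _ _ hx hy) le_rfl
  · intro a b hab
    exact iSup₂_le fun c hc => le_iSup₂_of_le c (hc.trans_le hab) le_rfl
  · intro f s hf hs
    refine ⟨?_, fun r hr => iSup₂_le fun c hc => ?_⟩
    · rintro _ ⟨n, rfl⟩
      exact iSup₂_le fun c hc => le_iSup₂_of_le c (hc.trans_le (hs.1 ⟨n, rfl⟩)) le_rfl
    · obtain ⟨d, hcd, hds⟩ := hc.exists_between
      obtain ⟨n, hn⟩ := hds f hf s hs le_rfl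
      exact le_trans (le_iSup₂ (f := fun b (_ : CuBelow b (f n)) => φ b - μ b) c (hcd.trans_le hn))
        (hr ⟨n, rfl⟩)
  · intro a
    obtain ⟨f, hm, -, hf, hs⟩ := exists_approx a
    have hν : (⨆ b, ⨆ _ : CuBelow b a, (φ b - μ b)) = ⨆ n, (φ (f n) - μ (f n)) := by
      refine le_antisymm (iSup₂_le fun c hc => ?_) (iSup_le fun n => le_iSup₂_of_le _ (hf n) le_rfl)
      obtain ⟨n, hn⟩ := hc f hm a hs le_rfl
      exact le_iSup_of_le n (hmono _ _ _ hn (hf n))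
    change φ a = μ a + ⨆ b, ⨆ _ : CuBelow b a, (φ b - μ b)
    rw [hν, hφ.eq_iSup hm hs, hμ.eq_iSup hm hs, ENNReal.iSup_add_iSup_of_monotone]
    · exact iSup_congr fun n => (add_tsub_cancel_of_le (hle _)).symm
    · exact fun m n h => hμ.mono (hm h)
    · exact fun m n h => hmono _ _ _ (hm h) (hf n)

end IsCuFunctional

/-! ### Extremality and unboundedness of the other functionals. -/

/-- An extreme point of `F_{u ↦ 1}(S)` dominates, up to scaling, no other point. -/
theorem eq_of_le_mul (hO5 : AxiomO5 S) {u : S} (hfull : IsFullElement u) {φ μ : S → ℝ≥0∞}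
    (hφ : φ ∈ extremeFunctionals u) (hμ : μ ∈ normalizedFunctionals u) {c : ℝ≥0} (hc : 1 < c)
    (hle : ∀ a, μ a ≤ c * φ a) : μ = φ := by
  obtain ⟨⟨hφF, hφu⟩, hext⟩ := hφ
  obtain ⟨hμF, hμu⟩ := hμ
  have hc0 : c ≠ 0 := (zero_lt_one.trans hc).ne'
  obtain ⟨ν, hνF, hν⟩ := (hφF.const_mul c).exists_add_eq hO5 hμF
    (fun a b h => ENNReal.mul_ne_top ENNReal.coe_ne_top (hφF.ne_top_of_cuBelow hfull hφu h)) hle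
  obtain ⟨d, rfl⟩ : ∃ d, c = 1 + d := exists_add_of_le hc.le
  have hd : 0 < d := by simpa using hc
  have hνu : ν u = d := by
    have h := hν u
    rw [hφu, hμu, mul_one, ENNReal.coe_add, ENNReal.coe_one] at h
    exact ((ENNReal.add_right_inj ENNReal.one_ne_top).1 h).symm
  -- With `c = 1 + d`, `φ` is the convex combination of `μ` and `d⁻¹ ν` with weights `1 / c` and `d
  -- / c`.
  refine hext ⟨hμF, hμu⟩ (x₂ := fun a => ((d⁻¹ : ℝ≥0) : ℝ≥0∞) * ν a) ⟨hνF.const_mul _, ?_⟩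
    ⟨(1 + d)⁻¹, (1 + d)⁻¹ * d, by positivity, by positivity, by field_simp, ?_⟩
  · change ((d⁻¹ : ℝ≥0) : ℝ≥0∞) * ν u = 1
    rw [hνu, ← ENNReal.coe_mul, inv_mul_cancel₀ hd.ne', ENNReal.coe_one]
  · funext a
    have h1 : (((1 + d)⁻¹ * d : ℝ≥0) : ℝ≥0∞) * (((d⁻¹ : ℝ≥0) : ℝ≥0∞) * ν a) =
        (((1 + d)⁻¹ : ℝ≥0) : ℝ≥0∞) * ν a := by
      rw [← mul_assoc, ← ENNReal.coe_mul, mul_assoc, mul_inv_cancel₀ hd.ne', mul_one]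
    simp only [Pi.add_apply, Pi.smul_apply, ENNReal.smul_def, smul_eq_mul]
    rw [h1, ← mul_add, ← hν a, ← mul_assoc, ← ENNReal.coe_mul, inv_mul_cancel₀ hc0,
      ENNReal.coe_one, one_mul]

/-- A linear bound on elements of small `φ`-rank propagates to all elements of finite `φ`-rank, at
the cost of a factor `2`. -/
theorem le_mul_of_le_mul_small (hO5 : AxiomO5 S) {φ μ : S → ℝ≥0∞} (hφ : IsCuFunctional φ)
    (hμ : IsCuFunctional μ) (hE : EdwardsConditionFor φ) {t c : ℝ≥0∞} {d : S} (hd0 : φ d ≠ 0)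
    (hdt : φ d < t) (hsmall : ∀ b, φ b < t → μ b ≤ c * φ b) {b : S} (hb : φ b ≠ ⊤) :
    μ b ≤ 2 * c * φ b := by
  have hdtop : φ d ≠ ⊤ := hdt.ne_top
  -- Each induction step splits off a piece of rank at least `δ`: Edwards' condition halves `φ d`
  -- once, and passing to `e' ≪ e` halves it again.
  set δ := φ d / 2 / 2 with hδ
  have hδ0 : δ ≠ 0 := by simp [hδ, ENNReal.div_eq_zero_iff, hd0]
  have key : ∀ k : ℕ, ∀ b, φ b < t + k * δ → μ b ≤ 2 * c * φ b := by
    intro k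
    induction k with
    | zero =>
      intro b hb
      refine (hsmall b (by simpa using hb)).trans ?_
      gcongr
      exact le_mul_of_one_le_left' one_le_two
    | succ k ih =>
      intro b hb
      rcases lt_or_ge (φ b) t with hbt | hbt
      · refine (hsmall b hbt).trans ?_
        gcongr
        exact le_mul_of_one_le_left' one_le_two
      have hhalf : φ d / 2 < φ d := ENNReal.half_lt_self hd0 hdtop
      obtain ⟨e, heb, hed, he⟩ := hE.exists_lt (hhalf.trans (hdt.trans_le hbt)) hhalf
      have het : φ e < t := (hφ.mono hed).trans_lt hdt
      have he0 : φ e ≠ 0 := (zero_le.trans_lt he).ne'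
      obtain ⟨e', hee, he'⟩ := hφ.exists_cuBelow_lt (ENNReal.half_lt_self he0 het.ne_top)
      obtain ⟨x, h1, h2, -⟩ := hO5 e' e 0 0 b (by simpa using heb) hee (cuBelow_zero 0)
      have h1' := hφ.mono h1
      rw [hφ.map_add] at h1'
      have h2' := hμ.mono h2
      rw [hμ.map_add] at h2'
      have hδe : δ ≤ φ e' := (ENNReal.div_le_div_right he.le 2).trans he'.le
      have hδtop : δ ≠ ⊤ := ne_top_of_le_ne_top het.ne_top (hδe.trans (hφ.mono hee.le))
      have hx : φ x < t + k * δ := by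
        refine lt_of_add_lt_add_left (a := δ) ?_
        calc δ + φ x ≤ φ e' + φ x := by gcongr
          _ ≤ φ b := h1'
          _ < t + (k + 1 : ℕ) * δ := hb
          _ = δ + (t + k * δ) := by push_cast; ring
      have hee2 : φ e ≤ 2 * φ e' := by
        have := (ENNReal.div_lt_iff (by simp) (by simp)).1 he'
        rw [mul_comm]
        exact this.le
      calc μ b ≤ μ e + μ x := h2'
        _ ≤ c * (2 * φ e') + 2 * c * φ x := by
          gcongr
          · exact (hsmall e het).trans (by gcongr)
          · exact ih x hx
        _ = 2 * c * (φ e' + φ x) := by ring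
        _ ≤ 2 * c * φ b := by gcongr
  obtain ⟨k, hk⟩ := ENNReal.exists_nat_mul_gt hδ0 hb
  exact key k b (hk.trans_le le_add_self)

theorem exists_lt_rank (hsimple : IsSimpleCu S) (hnonelem : ¬ IsElementaryCu S)
    (hO5 : AxiomO5 S) {u : S} (hfull : IsFullElement u) {φ μ : S → ℝ≥0∞}
    (hφ : φ ∈ extremeFunctionals u) (hE : EdwardsConditionFor φ)
    (hμ : μ ∈ normalizedFunctionals u) (hne : μ ≠ φ) {t : ℝ≥0} (ht : 0 < t) (N : ℝ≥0) :
    ∃ b, φ b < t ∧ N < μ b := by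
  by_contra! hN
  obtain ⟨⟨hφF, hφu⟩, -⟩ := id hφ
  obtain ⟨d, hd0, hdt⟩ := hφF.exists_small hsimple hnonelem hO5 hφu (ENNReal.coe_ne_zero.2 ht.ne')
  have hsmall : ∀ b, φ b < t → μ b ≤ ((2 * N / t : ℝ≥0) : ℝ≥0∞) * φ b := by
    intro b hb
    by_cases hb0 : b = 0
    · simp [hb0, hμ.1.map_zero]
    have h := mul_le_of_bounded hφF hμ.1 ENNReal.coe_ne_top hN
      (hφF.ne_zero hsimple (hφu ▸ one_ne_zero) hb0) hb
    rw [ENNReal.coe_div ht.ne', mul_comm, ← mul_div_assoc,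
      ENNReal.le_div_iff_mul_le (by simp [ht.ne']) (by simp)]
    refine h.trans (le_of_eq ?_)
    push_cast
    ring
  -- The summand `2` only ensures that the constant exceeds `1`.
  refine hne (eq_of_le_mul hO5 hfull hφ hμ (c := 2 * (2 * N / t) + 2) ?_ fun b => ?_)
  · exact one_lt_two.trans_le le_add_self
  · by_cases hb : φ b = ⊤
    · rw [hb, ENNReal.mul_top (by positivity)]
      exact le_top
    · refine (le_mul_of_le_mul_small hO5 hφF hμ.1 hE hd0 hdt hsmall hb).trans ?_
      gcongr
      push_cast
      exact le_self_add

/-! ### Directedness by complements and the dominating element. -/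

/-- Elements compactly contained in an element of rank less than `t` are directed, up to comparing
one of the two by ranks only. -/
theorem exists_upper_bound (hO5 : AxiomO5 S) {u : S} (hcompact : IsCompactElt u)
    (hfull : IsFullElement u) {φ : S → ℝ≥0∞} (hφ : φ ∈ normalizedFunctionals u)
    (hE : EdwardsConditionFor φ) {t : ℝ≥0∞} (htop : t ≠ ⊤) {a b : S}
    (ha : ∃ a', CuBelow a a' ∧ φ a' < t) (hb : ∃ b', CuBelow b b' ∧ φ b' < t) :
    ∃ w, (∃ w', CuBelow w w' ∧ φ w' < t) ∧ a ≤ w ∧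
      ∀ μ ∈ normalizedFunctionals u, μ b ≤ μ w := by
  obtain ⟨hφF, hφu⟩ := hφ
  obtain ⟨a3, haa3, ha3⟩ := ha
  obtain ⟨b3, hbb3, hb3⟩ := hb
  obtain ⟨a2, haa2, ha23⟩ := haa3.exists_between
  obtain ⟨a1, haa1, ha12⟩ := haa2.exists_between
  obtain ⟨b2, hbb2, hb23⟩ := hbb3.exists_between
  obtain ⟨b1, hbb1, hb12⟩ := hbb2.exists_between
  obtain ⟨na, hna⟩ := hfull.exists_le_nsmul ha23
  obtain ⟨nb, hnb⟩ := hfull.exists_le_nsmul hb23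
  obtain ⟨nt, hnt⟩ := ENNReal.exists_nat_gt htop
  obtain ⟨n, hn_a, hn_b, hn_t⟩ : ∃ n : ℕ, na ≤ n ∧ nb ≤ n ∧ nt ≤ n :=
    ⟨na + nb + nt, by omega, by omega, by omega⟩
  have hrank : ∀ μ ∈ normalizedFunctionals u, μ (n • u) = n := by
    rintro μ ⟨hμ, hμu⟩
    rw [hμ.map_nsmul, hμu, mul_one]
  have hmul : ∀ {m}, m ≤ n → m • u ≤ n • u :=
    fun h => nsmul_le_nsmul_left (CuSemigroup.zero_le' u) h
  have htn : t ≤ n := hnt.le.trans (by exact_mod_cast hn_t)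
  have hcompl : ∀ p q : S, φ p < t → n • u ≤ p + q → n - t < φ q := by
    intro p q hp hpq
    have h := hφF.mono hpq
    rw [hrank φ ⟨hφF, hφu⟩, hφF.map_add] at h
    by_cases hq : φ q = ⊤
    · rw [hq]
      exact (tsub_le_self.trans_lt (ENNReal.natCast_lt_top n))
    · refine ENNReal.sub_lt_of_lt_add htn (h.trans_lt ?_)
      rw [add_comm]
      exact ENNReal.add_lt_add_left hq hp
  obtain ⟨x, hx1, hx2, -⟩ := hO5 a1 a2 0 0 (n • u) (by simpa using hna.trans (hmul hn_a)) ha12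
    (cuBelow_zero 0)
  obtain ⟨y, hy1, hy2, -⟩ := hO5 b1 b2 0 0 (n • u) (by simpa using hnb.trans (hmul hn_b)) hb12
    (cuBelow_zero 0)
  obtain ⟨z, hzx, hzy, hz⟩ := hE.exists_lt
    (hcompl a2 x ((hφF.mono ha23.le).trans_lt ha3) hx2)
    (hcompl b2 y ((hφF.mono hb23.le).trans_lt hb3) hy2)
  obtain ⟨z', hzz, hz'⟩ := hφF.exists_cuBelow_lt hz
  have hza : z + a1 ≤ n • u := (add_comm z a1).le.trans ((add_le_add_right hzx a1).trans hx1)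
  -- `w` is a complement of `z`, a common lower bound of the complements of `a` and `b`. The last
  -- clause of (O5) gives `a ≪ w`; for `b`, only ranks compare, by cancelling `μ z`.
  obtain ⟨w, hw1, hw2, haw⟩ := hO5 z' z a a1 (n • u) hza hzz haa1
  have hwt : φ w < t := by
    have h := hφF.mono hw1
    rw [hrank φ ⟨hφF, hφu⟩, hφF.map_add] at h
    have hwtop : φ w ≠ ⊤ := ne_top_of_le_ne_top (ENNReal.natCast_ne_top n) (le_add_self.trans h)
    by_contra! hcon
    refine absurd h (not_le.2 ?_)
    calc (n : ℝ≥0∞) = (n - t) + t := (tsub_add_cancel_of_le htn).symm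
      _ < φ z' + t := (ENNReal.add_lt_add_iff_right htop).2 hz'
      _ ≤ φ z' + φ w := by gcongr
  obtain ⟨f, hfm, -, hf, hfs⟩ := exists_approx w
  obtain ⟨i, hi⟩ := haw f hfm w hfs le_rfl
  -- Compactness of `n • u` lets some `f j ≪ w` replace `w`.
  obtain ⟨j, hj⟩ := hcompact.nsmul n (fun k => z + f k) (fun k l h => add_le_add_right (hfm h) z)
    (z + w) (CuSemigroup.sup_add (fun _ => z) f z w monotone_const hfm (by simp) hfs) hw2
  refine ⟨f (max i j), ⟨w, hf _, hwt⟩, hi.trans (hfm (le_max_left i j)), fun μ hμ => ?_⟩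
  have h1 : μ b1 + μ z ≤ n := by
    rw [← hμ.1.map_add, ← hrank μ hμ]
    exact hμ.1.mono ((add_le_add_right hzy b1).trans hy1)
  have h2 : (n : ℝ≥0∞) ≤ μ (f (max i j)) + μ z := by
    rw [← hμ.1.map_add, ← hrank μ hμ, add_comm]
    exact hμ.1.mono (hj.trans (add_le_add_right (hfm (le_max_right i j)) z))
  have hztop : μ z ≠ ⊤ :=
    ne_top_of_le_ne_top (ENNReal.natCast_ne_top n) (le_add_self.trans h1)
  exact (hμ.1.mono hbb1.le).trans ((ENNReal.add_le_add_iff_right hztop).1 (h1.trans h2))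

/-- An element of rank at most `t` at `φ` that dominates the rank of every element of rank less than
`t` at `φ`. -/
theorem exists_dominating (hbased : IsCountablyBased S) (hO5 : AxiomO5 S) {u : S}
    (hcompact : IsCompactElt u) (hfull : IsFullElement u) {φ : S → ℝ≥0∞}
    (hφ : φ ∈ normalizedFunctionals u) (hE : EdwardsConditionFor φ) {t : ℝ≥0∞} (ht : t ≠ 0)
    (htop : t ≠ ⊤) :
    ∃ a, φ a ≤ t ∧ ∀ μ ∈ normalizedFunctionals u, ∀ b, φ b < t → μ b ≤ μ a := by
  obtain ⟨B, hB, hbase⟩ := hbased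
  let P : S → Prop := fun a => ∃ a', CuBelow a a' ∧ φ a' < t
  have hP0 : P 0 := ⟨0, cuBelow_zero 0, by rw [hφ.1.map_zero]; exact pos_iff_ne_zero.2 ht⟩
  have hne : (insert 0 (B ∩ {b | P b})).Nonempty := Set.insert_nonempty _ _
  obtain ⟨g, hg⟩ := ((hB.mono Set.inter_subset_left).insert 0).exists_eq_range hne
  have hgP : ∀ n, P (g n) := by
    intro n
    have : g n ∈ insert 0 (B ∩ {b | P b}) := hg ▸ Set.mem_range_self n
    rcases this with h | h
    · exact h ▸ hP0
    · exact h.2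
  have hstep : ∀ (n : ℕ) (a : {a // P a}), ∃ w : {a // P a}, a.1 ≤ w.1 ∧
      ∀ μ ∈ normalizedFunctionals u, μ (g n) ≤ μ w.1 := by
    rintro n ⟨a, ha⟩
    obtain ⟨w, hw, h1, h2⟩ := exists_upper_bound hO5 hcompact hfull hφ hE htop ha (hgP n)
    exact ⟨⟨w, hw⟩, h1, h2⟩
  choose F hF1 hF2 using hstep
  -- `v (n + 1)` lies above `v n` and dominates `g n` in rank.
  let v : ℕ → {a // P a} := fun n => Nat.rec ⟨0, hP0⟩ F n
  have hvm : Monotone fun n => (v n).1 := monotone_nat_of_le_succ fun n => hF1 n (v n)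
  obtain ⟨a, ha⟩ := CuSemigroup.exists_sup _ hvm
  have hbound : ∀ μ ∈ normalizedFunctionals u, ∀ b, P b → μ b ≤ μ a := by
    rintro μ hμ b ⟨b', hbb, hb'⟩
    obtain ⟨f, hfm, hfB, hfs⟩ := hbase b
    rw [hμ.1.eq_iSup hfm hfs]
    refine iSup_le fun n => ?_
    have hmem : f n ∈ insert 0 (B ∩ {b | P b}) :=
      Or.inr ⟨hfB n, b', hbb.of_le (hfs.1 ⟨n, rfl⟩), hb'⟩
    rw [hg] at hmem
    obtain ⟨m, hm⟩ := hmem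
    rw [← hm]
    exact (hF2 m (v m) μ hμ).trans (hμ.1.mono (ha.1 ⟨m + 1, rfl⟩))
  refine ⟨a, ?_, fun μ hμ b hb => ?_⟩
  · rw [hφ.1.eq_iSup hvm ha]
    refine iSup_le fun n => ?_
    obtain ⟨c, hc, hct⟩ := (v n).2
    exact (hφ.1.mono hc.le).trans hct.le
  · obtain ⟨f, hfm, -, hf, hfs⟩ := exists_approx b
    rw [hμ.1.eq_iSup hfm hfs]
    exact iSup_le fun n => hbound μ hμ _ ⟨b, hf n, hb⟩

/-- If `r < t`, take `d` with `0 < φ d < t - r`: adding one more `d` to a multiple of rank at most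
`r` stays below `t`, hence again at most `r`, contradicting `r < ∞`. -/
theorem le_of_forall_rank_lt (hsimple : IsSimpleCu S) (hnonelem : ¬ IsElementaryCu S)
    (hO5 : AxiomO5 S) {u : S} {φ : S → ℝ≥0∞} (hφ : φ ∈ normalizedFunctionals u) {t r : ℝ≥0∞}
    (h : ∀ b, φ b < t → φ b ≤ r) : t ≤ r := by
  by_contra! hrt
  obtain ⟨d, hd0, hd⟩ := hφ.1.exists_small hsimple hnonelem hO5 hφ.2 (tsub_pos_of_lt hrt).ne'
  have hdr : φ d + r < t := lt_tsub_iff_right.1 hd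
  have key : ∀ k : ℕ, k * φ d ≤ r := by
    intro k
    induction k with
    | zero => simp
    | succ k ih =>
      rw [← hφ.1.map_nsmul]
      apply h
      rw [hφ.1.map_nsmul]
      refine lt_of_le_of_lt ?_ hdr
      push_cast
      rw [add_mul, one_mul, add_comm]
      gcongr
  obtain ⟨k, hk⟩ := ENNReal.exists_nat_mul_gt hd0 hrt.ne_top
  exact absurd (key k) (not_le.2 hk)

end CuSemigroup

theorem proposition4p4 {S : Type*} [AddCommMonoid S] [PartialOrder S] [IsOrderedAddMonoid S]
    [CuSemigroup S] (hbased : IsCountablyBased S) (hsimple : IsSimpleCu S)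
    (hnonelem : ¬ IsElementaryCu S) (hO5 : AxiomO5 S) (hO6 : AxiomO6 S)
    (u : S) (hcompact : IsCompactElt u) (hfull : IsFullElement u)
    (hEdwards : ∀ φ ∈ extremeFunctionals u, EdwardsConditionFor φ) :
    ∀ φ ∈ extremeFunctionals u, ∀ t : ℝ, 0 < t →
      ∃ a : S, rankOn u a = chisel (normalizedFunctionals u) φ t := by
  intro φ hφ t ht
  lift t to ℝ≥0 using ht.le
  have ht' : 0 < t := by exact_mod_cast ht
  have hE := hEdwards φ hφ
  have hφK : φ ∈ normalizedFunctionals u := hφ.1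
  obtain ⟨a, hat, ha⟩ := exists_dominating hbased hO5 hcompact hfull hφK hE
    (ENNReal.coe_ne_zero.2 ht'.ne') ENNReal.coe_ne_top
  refine ⟨a, funext fun μ => ?_⟩
  obtain ⟨μ, hμ⟩ := μ
  by_cases hμφ : μ = φ
  · subst hμφ
    have : μ a = t := hat.antisymm (le_of_forall_rank_lt hsimple hnonelem hO5 hφK
      (ha μ hφK))
    simp only [rankOn, chisel, chiselBase, this, if_true, add_zero]
    rfl
  · have : μ a = ⊤ := by
      refine ENNReal.eq_top_of_forall_nnreal_le fun N => ?_
      obtain ⟨b, hb, hNb⟩ := exists_lt_rank hsimple hnonelem hO5 hfull hφ hE hμ hμφ ht' N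
      exact hNb.le.trans (ha μ hμ b hb)
    simp [rankOn, chisel, chiselBase, this, hμφ]
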